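/- A symmetric configuration $v_3$ consists of a set of $v$ points and $v$ blocks such that each block contains exactly three points, each point lies in exactly three blocks, and any two distinct points lie together in at most one block. It is connected if it has at least one point and is not the union of two configurations on complementary nonempty point sets. A triangle in it is a set of three blocks of the form $\{a,b,f\},\{a,c,e\},\{b,c,d\}$ with $a,b,c,d,e,f$ distinct. Its Levi graph has the points and the blocks as vertices, a point being adjacent to the blocks that contain it. Let $v\ge 0$ be an integer. A connected symmetric configuration $v_3$ with no triangles exists if and only if $v=15$ or $v\ge 17$. Equivalently, a connected cubic bipartite graph of girth at least $8$ on $2v$ vertices exists if and only if $v=15$ or $v\ge 17$; for $v\ge 1$ the same holds when the graph is not required to be connected. The equivalence is realized by Levi graphs: the Levi graph of every symmetric configuration $v_3$ is a cubic bipartite graph on $2v$ vertices, which is connected if and only if the configuration is connected, and has girth at least $8$ if and only if the configuration has no triangles. -/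

import Mathlib

/-- A symmetric configuration with block size 3 on the finite point set `P` (a configuration `v_3`
with `v = Fintype.card P`): there are as many blocks as points, each block has exactly three
points, each point lies in exactly three blocks, and two distinct points lie together in at most
one block.  A block is identified with its set of points; this loses nothing, because by the last
condition two blocks with the same three points coincide. -/
structure SymmetricConfiguration3 (P : Type*) [Fintype P] [DecidableEq P] where
  /-- the blocks (triples) -/
  blocks : Finset (Finset P)
  card_blocks : blocks.card = Fintype.card P
  card_of_mem : ∀ B ∈ blocks, B.card = 3
  card_through : ∀ p : P, (blocks.filter (fun B => p ∈ B)).card = 3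
  eq_of_pair : ∀ p q : P, p ≠ q → ∀ B ∈ blocks, ∀ B' ∈ blocks,
    p ∈ B → q ∈ B → p ∈ B' → q ∈ B' → B = B'

namespace SymmetricConfiguration3

/-- The configuration is disconnected (decomposable): it is the union of two configurations on
complementary nonempty point sets `S` and `Sᶜ`.  (Each of the two parts is then again a symmetric
configuration, because all blocks through a point of `S` lie inside `S`, and likewise for `Sᶜ`.) -/
def Disconnected {P : Type*} [Fintype P] [DecidableEq P]
    (C : SymmetricConfiguration3 P) : Prop :=
  ∃ S : Finset P, S.Nonempty ∧ Sᶜ.Nonempty ∧ ∀ B ∈ C.blocks, B ⊆ S ∨ B ⊆ Sᶜ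

/-- The configuration is connected: it has a point and is not disconnected. -/
def Connected {P : Type*} [Fintype P] [DecidableEq P]
    (C : SymmetricConfiguration3 P) : Prop :=
  Nonempty P ∧ ¬ C.Disconnected

/-- The configuration contains a triangle, that is, three blocks `abf`, `ace`, `bcd` on six
distinct points. -/
def HasTriangle {P : Type*} [Fintype P] [DecidableEq P]
    (C : SymmetricConfiguration3 P) : Prop :=
  ∃ a b c d e f : P, [a, b, c, d, e, f].Nodup ∧
    {a, b, f} ∈ C.blocks ∧ {a, c, e} ∈ C.blocks ∧ {b, c, d} ∈ C.blocks

/-- The Levi graph (point-block incidence graph): the vertices are the points and the blocks, and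
a point is joined to every block containing it. -/
def leviGraph {P : Type*} [Fintype P] [DecidableEq P]
    (C : SymmetricConfiguration3 P) : SimpleGraph (P ⊕ {B : Finset P // B ∈ C.blocks}) :=
  SimpleGraph.fromRel (fun x y => ∃ (p : P) (B : {B : Finset P // B ∈ C.blocks}),
    x = Sum.inl p ∧ y = Sum.inr B ∧ p ∈ B.1)

end SymmetricConfiguration3

/-- A graph is cubic if it is 3-regular. -/
def IsCubicGraph {V : Type*} (G : SimpleGraph V) : Prop :=
  ∃ _ : G.LocallyFinite, G.IsRegularOfDegree 3

/-! Girth at least 8 in a bipartite graph means no 4-cycles and no 6-cycles, that is, linearity and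
freedom from triangles; so everything is proved for a cubic incidence relation.

Nonexistence. Of the 27 walks of length three from a point, 15 end on its own three lines and every
other line receives at most one; so exactly v − 15 lines are far from it, and v ≥ 15. If v = 16,
pairing each point with its only far line gives an incidence matrix N with zero diagonal and N Nᵀ N
= 4N + J − 1. This forces N to be symmetric, hence N³ = 4N + J − 1, and the trace of N⁵ contradicts
tr(N⁵) = (tr N)⁵ modulo 5 (`card_ne_sixteen`).

Existence. The Levi graphs are built as a Hamiltonian cycle plus a perfect matching. Exchanging the
ends of one cycle edge from each of two such graphs merges them into one and creates no short cycle
(`IsHamiltonianPair.join`). Adding the solution with 15 points repeatedly leaves only v = 15, 17, …,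
29 and 31 to be given by tables. -/

/-! ### Incidence relations and their bipartite graphs -/

section Incidence

variable {P L : Type*}

/-- The bipartite graph of an incidence relation between points and lines. -/
def incidenceGraph (I : P → L → Prop) : SimpleGraph (P ⊕ L) :=
  SimpleGraph.fromRel (fun x y => ∃ p l, x = Sum.inl p ∧ y = Sum.inr l ∧ I p l)

/-- Two distinct points lie together on at most one line. -/
def IsLinear (I : P → L → Prop) : Prop :=
  ∀ p q l m, I p l → I q l → I q m → I p m → p = q ∨ l = m

/-- No three distinct points are pairwise joined by three distinct lines. -/
def IsTriangleFree (I : P → L → Prop) : Prop :=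
  ∀ p q r l m n, I p l → I q l → I q m → I r m → I r n → I p n →
    p ≠ q → q ≠ r → p ≠ r → l ≠ m → m ≠ n → l ≠ n → False

/-- Three lines on every point and three points on every line. -/
structure IsCubicIncidence (I : P → L → Prop) : Prop where
  lines : ∀ p, {l | I p l}.ncard = 3
  points : ∀ l, {p | I p l}.ncard = 3

/-- Every nonempty set of points closed under collinearity is everything. -/
def IsConnectedIncidence (I : P → L → Prop) : Prop :=
  ∀ S : Set P, S.Nonempty → (∀ p q l, p ∈ S → I p l → I q l → q ∈ S) → S = Set.univ

variable {I : P → L → Prop}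

@[simp] lemma incidenceGraph_adj_inl_inr {p : P} {l : L} :
    (incidenceGraph I).Adj (Sum.inl p) (Sum.inr l) ↔ I p l := by
  simp [incidenceGraph]

@[simp] lemma incidenceGraph_adj_inr_inl {p : P} {l : L} :
    (incidenceGraph I).Adj (Sum.inr l) (Sum.inl p) ↔ I p l := by
  simp [incidenceGraph]

@[simp] lemma incidenceGraph_adj_inl_inl {p q : P} :
    ¬ (incidenceGraph I).Adj (Sum.inl p) (Sum.inl q) := by
  simp [incidenceGraph]

@[simp] lemma incidenceGraph_adj_inr_inr {l m : L} :
    ¬ (incidenceGraph I).Adj (Sum.inr l) (Sum.inr m) := by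
  simp [incidenceGraph]

lemma no_four_cycle {V : Type*} {G : SimpleGraph V} (h : 8 ≤ G.egirth) {a b c d : V}
    (h₁ : G.Adj a b) (h₂ : G.Adj b c) (h₃ : G.Adj c d) (h₄ : G.Adj d a) : a = c ∨ b = d := by
  by_contra! hne
  obtain ⟨hac, hbd⟩ := hne
  have hw := SimpleGraph.le_egirth.1 h a (.cons h₁ (.cons h₂ (.cons h₃ (.cons h₄ .nil)))) (by
    have := h₁.ne; have := h₂.ne; have := h₃.ne; have := h₄.ne
    rw [SimpleGraph.Walk.cons_isCycle_iff]
    simp [SimpleGraph.Walk.cons_isPath_iff, *, Ne.symm])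
  simp at hw
  exact absurd hw (by decide)

lemma no_six_cycle {V : Type*} {G : SimpleGraph V} (h : 8 ≤ G.egirth) {a b c d e f : V}
    (h₁ : G.Adj a b) (h₂ : G.Adj b c) (h₃ : G.Adj c d) (h₄ : G.Adj d e) (h₅ : G.Adj e f)
    (h₆ : G.Adj f a) (hn : [a, b, c, d, e, f].Nodup) : False := by
  have hw := SimpleGraph.le_egirth.1 h a
    (.cons h₁ (.cons h₂ (.cons h₃ (.cons h₄ (.cons h₅ (.cons h₆ .nil)))))) (by
    rw [SimpleGraph.Walk.cons_isCycle_iff]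
    simp at hn
    simp [SimpleGraph.Walk.cons_isPath_iff]
    grind)
  simp at hw
  exact absurd hw (by decide)

lemma eight_le_egirth_incidenceGraph_iff :
    8 ≤ (incidenceGraph I).egirth ↔ IsLinear I ∧ IsTriangleFree I := by
  refine ⟨fun h => ⟨fun p q l m h₁ h₂ h₃ h₄ => ?_, ?_⟩, fun ⟨hl, ht⟩ => ?_⟩
  · simpa using no_four_cycle h (a := Sum.inl p) (b := Sum.inr l) (c := Sum.inl q)
      (d := Sum.inr m) (by simpa) (by simpa) (by simpa) (by simpa)
  · intro p q r l m n h₁ h₂ h₃ h₄ h₅ h₆ hpq hqr hpr hlm hmn hln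
    refine no_six_cycle h (a := Sum.inl p) (b := Sum.inr l) (c := Sum.inl q)
      (d := Sum.inr m) (e := Sum.inl r) (f := Sum.inr n) (by simpa) (by simpa) (by simpa)
      (by simpa) (by simpa) (by simpa) ?_
    simp [*]
  · rw [SimpleGraph.le_egirth]
    intro a w hw
    by_contra! hlt
    have hlt : w.length < 8 := by exact_mod_cast hlt
    -- The closed walk is unrolled edge by edge: odd lengths contradict the bipartition, lengths 0
    -- and 2 are no cycles, length 4 contradicts linearity and length 6 is a triangle.
    rcases w with _ | @⟨_, b, _, h₁, w⟩
    · simp at hw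
    rcases w with _ | @⟨_, c, _, h₂, w⟩
    · simp at h₁
    rcases w with _ | @⟨_, d, _, h₃, w⟩
    · rw [SimpleGraph.Walk.cons_isCycle_iff] at hw
      simp at hw
    rcases w with _ | @⟨_, e, _, h₄, w⟩
    · rcases a with a | a <;> rcases b with b | b <;> rcases c with c | c <;> simp at h₁ h₂ h₃
    rcases w with _ | @⟨_, f, _, h₅, w⟩
    · rw [SimpleGraph.Walk.cons_isCycle_iff] at hw
      simp at hw
      rcases a with a | a <;> rcases b with b | b <;> simp at h₁ <;> rcases c with c | c <;>
        simp at h₂ <;> rcases d with d | d <;> simp at h₃ h₄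
      · have := hl _ _ _ _ h₁ h₂ h₃ h₄
        grind
      · have := hl _ _ _ _ h₂ h₃ h₄ h₁
        grind
    rcases w with _ | @⟨_, g, _, h₆, w⟩
    · rcases a with a | a <;> rcases b with b | b <;> simp at h₁ <;> rcases c with c | c <;>
        simp at h₂ <;> rcases d with d | d <;> simp at h₃ <;> rcases e with e | e <;> simp at h₄ h₅
    rcases w with _ | @⟨_, h, _, h₇, w⟩
    · rw [SimpleGraph.Walk.cons_isCycle_iff] at hw
      simp at hw
      rcases a with a | a <;> rcases b with b | b <;> simp at h₁ <;> rcases c with c | c <;>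
        simp at h₂ <;> rcases d with d | d <;> simp at h₃ <;> rcases e with e | e <;>
        simp at h₄ <;> rcases f with f | f <;> simp at h₅ h₆
      · apply ht _ _ _ _ _ _ h₁ h₂ h₃ h₄ h₅ h₆ <;> grind
      · apply ht _ _ _ _ _ _ h₂ h₃ h₄ h₅ h₆ h₁ <;> grind
    rcases w with _ | @⟨_, i, _, h₈, w⟩
    · rcases a with a | a <;> rcases b with b | b <;> simp at h₁ <;> rcases c with c | c <;>
        simp at h₂ <;> rcases d with d | d <;> simp at h₃ <;> rcases e with e | e <;>
        simp at h₄ <;> rcases f with f | f <;> simp at h₅ <;> rcases g with g | g <;> simp at h₆ h₇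
    simp at hlt
    omega

lemma isBipartite_incidenceGraph (I : P → L → Prop) : (incidenceGraph I).IsBipartite :=
  ⟨SimpleGraph.Coloring.mk (Sum.elim (fun _ => 0) (fun _ => 1)) (by
    rintro (a | a) (b | b) <;> simp)⟩

/-- Counting with `ncard` removes the dependence on the choice of a `LocallyFinite` instance. -/
lemma isCubicGraph_iff {V : Type*} [Finite V] {G : SimpleGraph V} :
    IsCubicGraph G ↔ ∀ v, (G.neighborSet v).ncard = 3 := by
  constructor
  · rintro ⟨_, h⟩ v
    rw [← h v, ← SimpleGraph.card_neighborSet_eq_degree, Set.ncard_eq_toFinset_card',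
      Set.toFinset_card]
  · intro h
    have : G.LocallyFinite := fun v => Fintype.ofFinite _
    refine ⟨this, fun v => ?_⟩
    rw [← h v, ← SimpleGraph.card_neighborSet_eq_degree, Set.ncard_eq_toFinset_card',
      Set.toFinset_card]

lemma isCubicGraph_incidenceGraph [Finite P] [Finite L] (h : IsCubicIncidence I) :
    IsCubicGraph (incidenceGraph I) := by
  rw [isCubicGraph_iff]
  rintro (p | l)
  · have : (incidenceGraph I).neighborSet (Sum.inl p) = Sum.inr '' {l | I p l} := by
      ext (q | l) <;> simp
    rw [this, Set.ncard_image_of_injective _ Sum.inr_injective, h.lines]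
  · have : (incidenceGraph I).neighborSet (Sum.inr l) = Sum.inl '' {p | I p l} := by
      ext (q | l) <;> simp
    rw [this, Set.ncard_image_of_injective _ Sum.inl_injective, h.points]

lemma connected_incidenceGraph_iff (h : IsCubicIncidence I) :
    (incidenceGraph I).Connected ↔ Nonempty P ∧ IsConnectedIncidence I := by
  have hpt (l : L) : ∃ p, I p l :=
    Set.nonempty_of_ncard_ne_zero (s := {p | I p l}) (by rw [h.points]; decide)
  constructor
  · intro hc
    have hP : Nonempty P := by
      obtain ⟨p | l⟩ := hc.nonempty
      · exact ⟨p⟩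
      · exact (hpt l).nonempty
    refine ⟨hP, fun S ⟨p, hp⟩ hS => Set.eq_univ_of_forall fun q => ?_⟩
    -- Walks preserve the set consisting of S and of the lines that meet S.
    have key : ∀ x y, (incidenceGraph I).Reachable x y →
        Sum.elim (· ∈ S) (fun l => ∃ p ∈ S, I p l) x →
        Sum.elim (· ∈ S) (fun l => ∃ p ∈ S, I p l) y := by
      rintro x y ⟨w⟩
      induction w with
      | nil => exact id
      | @cons u v _ hadj _ ih =>
        intro hu
        apply ih
        rcases u with u | u <;> rcases v with v | v <;> simp at hadj hu ⊢
        · exact ⟨u, hu, hadj⟩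
        · obtain ⟨r, hr, hru⟩ := hu
          exact hS _ _ _ hr hru hadj
    exact key _ _ (hc.preconnected (Sum.inl p) (Sum.inl q)) hp
  · rintro ⟨⟨p⟩, hc⟩
    have hp : ∀ q, (incidenceGraph I).Reachable (Sum.inl p) (Sum.inl q) := by
      have := hc {q | (incidenceGraph I).Reachable (Sum.inl p) (Sum.inl q)} ⟨p, .refl _⟩ (by
        intro q r l hq hql hrl
        refine hq.trans (SimpleGraph.Reachable.trans (v := Sum.inr l) ?_ ?_) <;>
          exact SimpleGraph.Adj.reachable (by simpa))
      exact fun q => Set.eq_univ_iff_forall.1 this q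
    rw [SimpleGraph.connected_iff_exists_forall_reachable]
    refine ⟨Sum.inl p, ?_⟩
    rintro (q | l)
    · exact hp q
    · obtain ⟨q, hq⟩ := hpt l
      exact (hp q).trans (SimpleGraph.Adj.reachable (by simpa))

end Incidence

/-! ### Configurations and their Levi graphs -/

namespace SymmetricConfiguration3

variable {P : Type*} [Fintype P] [DecidableEq P] (C : SymmetricConfiguration3 P)

/-- The incidence relation between points and blocks. -/
def Incident (p : P) (B : {B : Finset P // B ∈ C.blocks}) : Prop := p ∈ B.1

lemma leviGraph_eq : C.leviGraph = incidenceGraph C.Incident := rfl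

lemma isCubicIncidence : IsCubicIncidence C.Incident where
  lines p := by
    have : Subtype.val '' {l | C.Incident p l} =
        (C.blocks.filter (fun B => p ∈ B) : Set (Finset P)) := by
      ext B
      simp [Incident, and_comm]
    rw [← Set.ncard_image_of_injective _ Subtype.val_injective, this, Set.ncard_coe_finset,
      C.card_through]
  points l := by
    have : {p | C.Incident p l} = (l.1 : Set P) := rfl
    rw [this, Set.ncard_coe_finset, C.card_of_mem _ l.2]

lemma isLinear : IsLinear C.Incident := by
  intro p q l m h₁ h₂ h₃ h₄
  by_cases h : p = q
  · exact .inl h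
  · exact .inr (Subtype.ext (C.eq_of_pair p q h _ l.2 _ m.2 h₁ h₂ h₄ h₃))

lemma exists_third {B : Finset P} (hB : B ∈ C.blocks) {p q : P} (hp : p ∈ B) (hq : q ∈ B)
    (hpq : p ≠ q) : ∃ r, p ≠ r ∧ q ≠ r ∧ B = {p, q, r} := by
  have hsub : ({p, q} : Finset P) ⊆ B := by simp [Finset.insert_subset_iff, hp, hq]
  have hc : (B \ {p, q}).card = 1 := by
    rw [Finset.card_sdiff_of_subset hsub, C.card_of_mem B hB, Finset.card_pair hpq]
  obtain ⟨r, hr⟩ := Finset.card_eq_one.1 hc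
  have hr' : r ∈ B \ {p, q} := by simp [hr]
  simp at hr'
  refine ⟨r, by grind, by grind, ?_⟩
  rw [← Finset.union_sdiff_of_subset hsub, hr]
  ext; simp

/-- The third points d, e, f of the three sides are automatically new and distinct: any coincidence
would put two points on two different blocks. So the six-point form of a triangle asks no more than
three corners and three distinct sides. -/
lemma isTriangleFree_iff : IsTriangleFree C.Incident ↔ ¬ C.HasTriangle := by
  constructor
  · rintro h ⟨a, b, c, d, e, f, hn, h₁, h₂, h₃⟩
    simp at hn
    refine h a b c ⟨_, h₁⟩ ⟨_, h₃⟩ ⟨_, h₂⟩ (by simp [Incident]) (by simp [Incident])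
      (by simp [Incident]) (by simp [Incident]) (by simp [Incident]) (by simp [Incident])
      (by grind) (by grind) (by grind) ?_ ?_ ?_
    · intro h
      have : a ∈ ({b, c, d} : Finset P) := by simp [← Subtype.mk.inj h]
      simp at this
      grind
    · intro h
      have : a ∈ ({b, c, d} : Finset P) := by simp [Subtype.mk.inj h]
      simp at this
      grind
    · intro h
      have : b ∈ ({a, c, e} : Finset P) := by simp [← Subtype.mk.inj h]
      simp at this
      grind
  · intro h p q r l m n h₁ h₂ h₃ h₄ h₅ h₆ hpq hqr hpr hlm hmn hln
    obtain ⟨f, hpf, hqf, hl⟩ := C.exists_third l.2 h₁ h₂ hpq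
    obtain ⟨d, hqd, hrd, hm⟩ := C.exists_third m.2 h₃ h₄ hqr
    obtain ⟨e, hpe, hre, hn⟩ := C.exists_third n.2 h₆ h₅ hpr
    have hf : C.Incident f l := by simp [Incident, hl]
    have hd : C.Incident d m := by simp [Incident, hm]
    have he : C.Incident e n := by simp [Incident, hn]
    have hlin := C.isLinear
    have hpd : p ≠ d := by rintro rfl; have := hlin _ _ _ _ h₁ h₂ h₃ hd; grind
    have hqe : q ≠ e := by rintro rfl; have := hlin _ _ _ _ h₁ h₂ he h₆; grind
    have hrf : r ≠ f := by rintro rfl; have := hlin _ _ _ _ h₁ hf h₅ h₆; grind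
    have hde : d ≠ e := by rintro rfl; have := hlin _ _ _ _ h₄ hd he h₅; grind
    have hdf : d ≠ f := by rintro rfl; have := hlin _ _ _ _ h₂ hf hd h₃; grind
    have hef : e ≠ f := by rintro rfl; have := hlin _ _ _ _ h₁ hf he h₆; grind
    refine h ⟨p, q, r, d, e, f, ?_, hl ▸ l.2, hn ▸ n.2, hm ▸ m.2⟩
    simp
    grind

lemma isConnectedIncidence_iff : IsConnectedIncidence C.Incident ↔ ¬ C.Disconnected := by
  constructor
  · rintro h ⟨S, hS, ⟨q, hq⟩, hB⟩
    have := h S hS (by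
      intro p q l hp hpl hql
      rcases hB _ l.2 with h | h
      · exact h hql
      · have := h hpl
        simp at this hp
        contradiction)
    have hq' : q ∈ (S : Set P) := this.symm ▸ Set.mem_univ q
    simp at hq hq'
    contradiction
  · intro h S hS hcl
    by_contra hne
    classical
    obtain ⟨q, hq⟩ := (Set.ne_univ_iff_exists_notMem S).1 hne
    refine h ⟨S.toFinset, by simpa, ⟨q, by simpa⟩, fun B hB => ?_⟩
    by_cases hB' : ∃ p ∈ B, p ∈ S
    · obtain ⟨p, hp, hpS⟩ := hB'
      exact .inl fun r hr => by simpa using hcl p r ⟨B, hB⟩ hpS hp hr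
    · push Not at hB'
      exact .inr fun r hr => by simpa using hB' r hr

lemma connected_leviGraph_iff : C.leviGraph.Connected ↔ C.Connected := by
  rw [leviGraph_eq, connected_incidenceGraph_iff C.isCubicIncidence, isConnectedIncidence_iff,
    Connected]

lemma eight_le_egirth_leviGraph_iff : 8 ≤ C.leviGraph.egirth ↔ ¬ C.HasTriangle := by
  rw [leviGraph_eq, eight_le_egirth_incidenceGraph_iff, isTriangleFree_iff]
  exact and_iff_right C.isLinear

lemma card_leviGraph :
    Nat.card (P ⊕ {B : Finset P // B ∈ C.blocks}) = 2 * Fintype.card P := by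
  simp [C.card_blocks, two_mul]

end SymmetricConfiguration3

/-! ### Counting walks, and the exclusion of 16 points -/

section Nonexistence

open Finset
open scoped Classical

variable {P L : Type*} [Fintype P] [Fintype L] {I : P → L → Prop}

/-- The number of lines through two points. -/
noncomputable def commonLines (I : P → L → Prop) (p q : P) : ℕ := #{m | I p m ∧ I q m}

/-- The number of walks of length three from a point to a line in the incidence graph. -/
noncomputable def walksThree (I : P → L → Prop) (p : P) (l : L) : ℕ :=
  ∑ q with I q l, commonLines I p q

namespace IsCubicIncidence

variable (h : IsCubicIncidence I)
include h

omit [Fintype P] in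
lemma card_lines (p : P) : #{l | I p l} = 3 := by
  rw [← h.lines p, Set.ncard_eq_toFinset_card', Set.toFinset_ofPred]

omit [Fintype L] in
lemma card_points (l : L) : #{p | I p l} = 3 := by
  rw [← h.points l, Set.ncard_eq_toFinset_card', Set.toFinset_ofPred]

lemma card_eq : Fintype.card P = Fintype.card L := by
  have := sum_card_bipartiteAbove_eq_sum_card_bipartiteBelow (s := (univ : Finset P))
    (t := (univ : Finset L)) I
  simp only [bipartiteAbove, bipartiteBelow, h.card_lines, h.card_points] at this
  simpa using this

lemma sum_commonLines (p : P) : ∑ q, commonLines I p q = 9 := by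
  have := sum_card_bipartiteAbove_eq_sum_card_bipartiteBelow (s := (univ : Finset P))
    (t := ({m | I p m} : Finset L)) I
  simp only [bipartiteAbove, bipartiteBelow, filter_filter] at this
  simp only [commonLines, this, h.card_points, sum_const, h.card_lines, smul_eq_mul]

lemma sum_walksThree_lines (p : P) : ∑ l, walksThree I p l = 27 := by
  simp only [walksThree, sum_filter]
  rw [sum_comm]
  simp only [← sum_filter, sum_const, h.card_lines, smul_eq_mul, ← mul_sum, h.sum_commonLines,
    Nat.reduceMul]

lemma sum_walksThree_points (l : L) : ∑ p, walksThree I p l = 27 := by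
  simp only [walksThree]
  rw [sum_comm]
  have (q : P) : ∑ p, commonLines I p q = 9 := by
    simpa only [commonLines, and_comm] using h.sum_commonLines q
  simp only [this, sum_const, h.card_points, smul_eq_mul]

omit [Fintype P] in
lemma commonLines_self (p : P) : commonLines I p p = 3 := by
  simp [commonLines, h.card_lines]

omit h [Fintype P] in
lemma commonLines_le_one (hl : IsLinear I) {p q : P} (hpq : p ≠ q) : commonLines I p q ≤ 1 := by
  rw [commonLines, card_le_one]
  intro l hl₁ m hm
  simp at hl₁ hm
  exact (hl p q l m hl₁.1 hl₁.2 hm.2 hm.1).resolve_left hpq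

/-- The point p itself contributes its three lines, and each of the other two points of l
contributes only l: 3 + 1 + 1. -/
lemma walksThree_of_incident (hl : IsLinear I) {p : P} {l : L} (hpl : I p l) :
    walksThree I p l = 5 := by
  have hp : p ∈ ({q | I q l} : Finset P) := by simpa
  rw [walksThree, ← add_sum_erase _ _ hp, h.commonLines_self, sum_congr rfl (g := fun _ => 1)]
  · simp [card_erase_of_mem hp, h.card_points]
  · intro q hq
    simp at hq
    refine le_antisymm (commonLines_le_one hl (Ne.symm hq.1)) ?_
    rw [commonLines, Nat.succ_le_iff, card_pos]
    exact ⟨l, by simp [hpl, hq.2]⟩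

omit h in
-- Two such walks would reach l through different points q and r, since p and q have at most one
-- common line; then p, q, r form a triangle.
lemma walksThree_le_one (hl : IsLinear I) (ht : IsTriangleFree I) {p : P} {l : L}
    (hpl : ¬ I p l) : walksThree I p l ≤ 1 := by
  by_contra! hlt
  have hle : ∀ q ∈ ({q | I q l} : Finset P), commonLines I p q ≤ 1 := by
    intro q hq
    simp at hq
    exact commonLines_le_one hl (by rintro rfl; exact hpl hq)
  have : 1 < #{q ∈ ({q | I q l} : Finset P) | commonLines I p q ≠ 0} := by
    refine hlt.trans_le ?_
    rw [walksThree, ← sum_filter_ne_zero, card_eq_sum_ones]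
    exact sum_le_sum fun q hq => hle q (mem_filter.1 hq).1
  obtain ⟨q, hq, r, hr, hqr⟩ := one_lt_card.1 this
  simp only [mem_filter, mem_univ, true_and, commonLines, ← pos_iff_ne_zero, card_pos] at hq hr
  obtain ⟨hql, m, hm⟩ := hq
  obtain ⟨hrl, n, hn⟩ := hr
  simp at hm hn
  have hpq : p ≠ q := by rintro rfl; exact hpl hql
  have hpr : p ≠ r := by rintro rfl; exact hpl hrl
  have hml : m ≠ l := by rintro rfl; exact hpl hm.1
  have hln : l ≠ n := by rintro rfl; exact hpl hn.1
  have hmn : m ≠ n := by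
    rintro rfl
    exact hml ((hl q r m l hm.2 hn.2 hrl hql).resolve_left hqr)
  exact ht p q r m l n hm.1 hm.2 hql hrl hn.2 hn.1 hpq hqr hpr hml hln hmn

end IsCubicIncidence

/-- A line at distance at least five from a point in the incidence graph. -/
def IsFar (I : P → L → Prop) (p : P) (l : L) : Prop := ¬ I p l ∧ walksThree I p l = 0

/-- Summing f + [z] = 1 + 4[i] gives 27 + #z = |α| + 12. The abstract form serves both lines seen
from a point and points seen from a line. -/
lemma card_zeros_add {α : Type*} [Fintype α] {i z : α → Prop} {f : α → ℕ} (hi : #{a | i a} = 3)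
    (h₅ : ∀ a, i a → f a = 5) (h₁ : ∀ a, ¬ i a → f a ≤ 1) (hf : ∑ a, f a = 27)
    (hz : ∀ a, z a ↔ ¬ i a ∧ f a = 0) : #{a | z a} + 15 = Fintype.card α := by
  have key (a : α) : f a + (if z a then 1 else 0) = 1 + 4 * (if i a then 1 else 0) := by
    have := h₅ a
    have := h₁ a
    have := hz a
    split_ifs <;> grind
  have hs := sum_congr (rfl : (univ : Finset α) = univ) fun a _ => key a
  simp only [sum_add_distrib, ← mul_sum, sum_boole, Nat.cast_id, hi, hf, sum_const, card_univ,
    smul_eq_mul] at hs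
  omega

namespace IsCubicIncidence

variable (h : IsCubicIncidence I) (hl : IsLinear I) (ht : IsTriangleFree I)
include h hl ht

lemma card_far_lines (p : P) : #{l | IsFar I p l} + 15 = Fintype.card L :=
  card_zeros_add (h.card_lines p) (fun _ => h.walksThree_of_incident hl)
    (fun _ => walksThree_le_one hl ht) (h.sum_walksThree_lines p) fun _ => Iff.rfl

lemma card_far_points (l : L) : #{p | IsFar I p l} + 15 = Fintype.card P :=
  card_zeros_add (h.card_points l) (fun _ => h.walksThree_of_incident hl)
    (fun _ => walksThree_le_one hl ht) (h.sum_walksThree_points l) fun _ => Iff.rfl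

lemma exists_equiv_far (hP : Fintype.card P = 16) :
    ∃ e : P ≃ L, ∀ p l, IsFar I p l ↔ l = e p := by
  have hL := h.card_eq.symm.trans hP
  have h₁ (p : P) : ∃ l, ∀ m, IsFar I p m ↔ m = l := by
    obtain ⟨l, hl⟩ := card_eq_one.1 (show #{l | IsFar I p l} = 1 by
      have := h.card_far_lines hl ht p; omega)
    exact ⟨l, fun m => by simpa using Finset.ext_iff.1 hl m⟩
  have h₂ (l : L) : ∃ p, ∀ q, IsFar I q l ↔ q = p := by
    obtain ⟨p, hp⟩ := card_eq_one.1 (show #{p | IsFar I p l} = 1 by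
      have := h.card_far_points hl ht l; omega)
    exact ⟨p, fun q => by simpa using Finset.ext_iff.1 hp q⟩
  choose f hf using h₁
  choose g hg using h₂
  exact ⟨⟨f, g, fun p => ((hg _ _).1 ((hf _ _).2 rfl)).symm,
    fun l => ((hf _ _).1 ((hg _ _).2 rfl)).symm⟩, hf⟩

open Matrix in
lemma card_ne_sixteen : Fintype.card P ≠ 16 := by
  intro hP
  obtain ⟨e, he⟩ := h.exists_equiv_far hl ht hP
  -- Columns are labelled by far points, so that being far becomes the diagonal.
  let N : Matrix P P (ZMod 5) := of fun p q => if I p (e q) then 1 else 0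
  let J : Matrix P P (ZMod 5) := of fun _ _ => 1
  have hrow (p : P) : ∑ q, N p q = 3 := by
    simp only [N, of_apply]
    rw [e.sum_comp (fun l => if I p l then (1 : ZMod 5) else 0)]
    simp [h.card_lines]
  have hJt : J * Nᵀ = (3 : ZMod 5) • J := by
    ext p q
    simp [J, mul_apply, hrow]
  have hNNt : N * Nᵀ = of fun p q => (commonLines I p q : ZMod 5) := by
    ext p q
    simp only [N, mul_apply, transpose_apply, of_apply]
    rw [e.sum_comp (fun l => (if I p l then (1 : ZMod 5) else 0) * if I q l then 1 else 0)]
    simp [commonLines, ← ite_and, and_comm]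
  -- The entries count walks of length three: 5 = 4 + 1 for incident pairs, 0 = 1 − 1 on the
  -- diagonal, and 1 elsewhere.
  have hW : N * Nᵀ * N = (4 : ZMod 5) • N + J - 1 := by
    ext p q
    have : (N * Nᵀ * N) p q = (walksThree I p (e q) : ZMod 5) := by
      rw [hNNt]
      simp [N, mul_apply, walksThree, sum_filter]
    rw [this]
    by_cases hpq : I p (e q)
    · have hne : p ≠ q := by
        rintro rfl
        exact ((he p (e p)).2 rfl).1 hpq
      rw [h.walksThree_of_incident hl hpq]
      simp [N, J, hpq, hne]
      rfl
    · by_cases h0 : walksThree I p (e q) = 0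
      · obtain rfl : q = p := e.injective ((he p (e q)).1 ⟨hpq, h0⟩)
        simp [N, J, hpq, h0]
      · have hne : p ≠ q := by
          rintro rfl
          exact h0 ((he p (e p)).2 rfl).2
        have h1 : walksThree I p (e q) = 1 := by
          have := walksThree_le_one hl ht hpq
          omega
        simp [N, J, hpq, h1, hne]
  have hsymm : Nᵀ = N := by
    -- Multiplying `hW` by Nᵀ on the right isolates Nᵀ as an expression in symmetric matrices.
    have h₁ : Nᵀ = (4 : ZMod 5) • (N * Nᵀ) + (3 : ZMod 5) • J - N * Nᵀ * (N * Nᵀ) := by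
      rw [← mul_assoc, hW, sub_mul, add_mul, hJt]
      simp
    have hJT : Jᵀ = J := rfl
    have h₂ := congrArg transpose h₁
    simp only [transpose_sub, transpose_add, transpose_smul, transpose_mul, transpose_transpose,
      hJT] at h₂
    exact h₁.trans h₂.symm
  rw [hsymm] at hW hJt hNNt
  have h5 : N ^ 5 = (16 : ZMod 5) • N + (13 : ZMod 5) • J - (4 : ZMod 5) • 1 - N * N := by
    calc N ^ 5 = N * N * N * N * N := by simp only [pow_succ, pow_zero, one_mul]
      _ = _ := by
        rw [hW]
        simp only [sub_mul, add_mul, smul_mul_assoc, hJt, one_mul, hW]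
        module
  -- With tr N = 0, tr J = tr 1 = 16 and tr N² = 16 · 3 = 48, the trace of N⁵ is 208 − 64 − 48 = 96,
  -- which is 1 and not 0 modulo 5.
  have key : ¬ (16 : ZMod 5) • (0 : ZMod 5) + (13 : ZMod 5) • (16 : ZMod 5) -
      (4 : ZMod 5) • (16 : ZMod 5) - 48 = 0 ^ 5 := by decide
  have : Fact (Nat.Prime 5) := ⟨by norm_num⟩
  have htr := ZMod.trace_pow_card N
  have htN : trace N = 0 := by
    refine sum_eq_zero fun p _ => ?_
    have : ¬ I p (e p) := ((he p (e p)).2 rfl).1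
    simp [N, this]
  have htNN : trace (N * N) = 48 := by
    simp only [hNNt, trace, Matrix.diag, of_apply, h.commonLines_self]
    simp [hP]
    rfl
  have htJ : trace J = 16 := by simp [J, trace, hP]
  rw [h5] at htr
  simp only [trace_sub, trace_add, trace_smul, htN, htNN, htJ, trace_one, hP] at htr
  exact key htr

theorem card_eq_fifteen_or_seventeen_le [Nonempty P] :
    Fintype.card P = 15 ∨ 17 ≤ Fintype.card P := by
  have h₁ := h.card_far_lines hl ht (Classical.arbitrary P)
  have h₂ := h.card_ne_sixteen hl ht
  have h₃ := h.card_eq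
  omega

end IsCubicIncidence

theorem SimpleGraph.exists_card_of_isCubicGraph {V : Type*} [Fintype V] [Nonempty V]
    {G : SimpleGraph V} (hG : IsCubicGraph G) (hb : G.IsBipartite) (hg : 8 ≤ G.egirth) :
    ∃ v, Fintype.card V = 2 * v ∧ (v = 15 ∨ 17 ≤ v) := by
  obtain ⟨c⟩ := hb
  rw [isCubicGraph_iff] at hG
  -- One colour class serves as points, the other as lines.
  let I : {x // c x = 0} → {x // ¬ c x = 0} → Prop := fun p l => G.Adj p l
  have hadj {x y : V} (hxy : G.Adj x y) : c x = 0 ↔ ¬ c y = 0 := by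
    have := c.valid hxy
    grind
  have hc : IsCubicIncidence I := by
    constructor
    · intro p
      rw [← hG p, ← Set.ncard_image_of_injective _ Subtype.val_injective]
      congr 1
      ext x
      simp only [Set.mem_image, Set.mem_ofPred_eq, SimpleGraph.mem_neighborSet]
      exact ⟨by rintro ⟨l, hl, rfl⟩; exact hl, fun hx => ⟨⟨x, (hadj hx).1 p.2⟩, hx, rfl⟩⟩
    · intro l
      rw [← hG l, ← Set.ncard_image_of_injective _ Subtype.val_injective]
      congr 1
      ext x
      simp only [Set.mem_image, Set.mem_ofPred_eq, SimpleGraph.mem_neighborSet]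
      exact ⟨by rintro ⟨p, hp, rfl⟩; exact hp.symm,
        fun hx => ⟨⟨x, (hadj hx.symm).2 l.2⟩, hx.symm, rfl⟩⟩
  have hlin : IsLinear I := by
    intro p q l m h₁ h₂ h₃ h₄
    exact (no_four_cycle hg h₁ h₂.symm h₃ h₄.symm).imp Subtype.ext Subtype.ext
  have htri : IsTriangleFree I := by
    intro p q r l m n h₁ h₂ h₃ h₄ h₅ h₆ hpq hqr hpr hlm hmn hln
    refine no_six_cycle hg h₁ h₂.symm h₃ h₄.symm h₅ h₆.symm ?_
    have (p : {x // c x = 0}) (l : {x // ¬ c x = 0}) : p.1 ≠ l.1 := fun h => l.2 (h ▸ p.2)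
    simp [Subtype.coe_inj, fun p l => (this p l).symm, *]
  have hcard : Fintype.card V = 2 * Fintype.card {x // c x = 0} := by
    have := Fintype.card_subtype_compl (fun x => c x = 0)
    have := Fintype.card_subtype_le (fun x => c x = 0)
    have := hc.card_eq
    omega
  have hne : Nonempty {x // c x = 0} := by
    rw [← Fintype.card_pos_iff]
    have := Fintype.card_pos (α := V)
    omega
  exact ⟨_, hcard, hc.card_eq_fifteen_or_seventeen_le hlin htri⟩

end Nonexistence

/-! ### Hamiltonian pairs of permutations and their joins -/

section Existence

open Equiv

variable {X Y : Type*}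

/-- The incidence relation that is the union of the identity and of two permutations. -/
def permIncidence (g h : Perm X) (x y : X) : Prop := y = x ∨ y = g x ∨ y = h x

/-- The union of the identity, a cyclic permutation of all points and a further permutation
is a cubic incidence relation without digons and triangles. -/
structure IsHamiltonianPair (g h : Perm X) : Prop where
  cyclic : ∀ S : Set X, S.Nonempty → (∀ x ∈ S, g x ∈ S) → S = Set.univ
  ne : ∀ x, x ≠ g x ∧ x ≠ h x ∧ g x ≠ h x
  linear : IsLinear (permIncidence g h)
  triangleFree : IsTriangleFree (permIncidence g h)

namespace IsHamiltonianPair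

variable {g h : Perm X}

lemma isCubicIncidence (H : IsHamiltonianPair g h) : IsCubicIncidence (permIncidence g h) where
  lines p := by
    have : {l | permIncidence g h p l} = {p, g p, h p} := by ext; simp [permIncidence]
    rw [this, Set.ncard_eq_three]
    exact ⟨_, _, _, (H.ne p).1, (H.ne p).2.1, (H.ne p).2.2, rfl⟩
  points l := by
    have : {p | permIncidence g h p l} = {l, g.symm l, h.symm l} := by
      ext
      simp [permIncidence, Equiv.eq_symm_apply, eq_comm]
    rw [this, Set.ncard_eq_three]
    have h₁ := H.ne (g.symm l)
    have h₂ := H.ne (h.symm l)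
    simp only [apply_symm_apply] at h₁ h₂
    exact ⟨_, _, _, h₁.1.symm, h₂.2.1.symm, fun he => h₂.2.2 (by rw [← he]; simp), rfl⟩

lemma isConnectedIncidence (H : IsHamiltonianPair g h) :
    IsConnectedIncidence (permIncidence g h) := by
  intro S hS hcl
  -- The points x and g x both lie on the line g x.
  exact H.cyclic S hS fun x hx => hcl x (g x) (g x) hx (by simp [permIncidence])
    (by simp [permIncidence])

variable [DecidableEq X] [DecidableEq Y]

/-- Two cycles are joined to one by exchanging the images of one point of each. -/
def joinCycles (g₁ : Perm X) (g₂ : Perm Y) (a : X) (b : Y) : Perm (X ⊕ Y) :=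
  swap (Sum.inl a) (Sum.inr b) |>.trans (sumCongr g₁ g₂)

variable {g₁ h₁ : Perm X} {g₂ h₂ : Perm Y} {a : X} {b : Y}

@[simp] lemma joinCycles_inl_self :
    joinCycles g₁ g₂ a b (Sum.inl a) = Sum.inr (g₂ b) := by simp [joinCycles]

@[simp] lemma joinCycles_inr_self :
    joinCycles g₁ g₂ a b (Sum.inr b) = Sum.inl (g₁ a) := by simp [joinCycles]

lemma joinCycles_inl_of_ne {x : X} (hx : x ≠ a) :
    joinCycles g₁ g₂ a b (Sum.inl x) = Sum.inl (g₁ x) := by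
  simp [joinCycles, swap_apply_def, hx]

lemma joinCycles_inr_of_ne {y : Y} (hy : y ≠ b) :
    joinCycles g₁ g₂ a b (Sum.inr y) = Sum.inr (g₂ y) := by
  simp [joinCycles, swap_apply_def, hy]

/-- Only the flag (a, g₁ a) is lost in the first summand; `H₁.ne` ensures that neither the identity
nor h₁ supplies it again. -/
lemma permIncidence_inl_inl (H₁ : IsHamiltonianPair g₁ h₁) {x y : X} :
    permIncidence (joinCycles g₁ g₂ a b) (sumCongr h₁ h₂) (Sum.inl x) (Sum.inl y) ↔
      permIncidence g₁ h₁ x y ∧ ¬ (x = a ∧ y = g₁ a) := by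
  have := H₁.ne x
  by_cases hx : x = a
  · subst hx
    simp [permIncidence]
    grind
  · simp [permIncidence, joinCycles_inl_of_ne hx, hx]

lemma permIncidence_inr_inr (H₂ : IsHamiltonianPair g₂ h₂) {x y : Y} :
    permIncidence (joinCycles g₁ g₂ a b) (sumCongr h₁ h₂) (Sum.inr x) (Sum.inr y) ↔
      permIncidence g₂ h₂ x y ∧ ¬ (x = b ∧ y = g₂ b) := by
  have := H₂.ne x
  by_cases hx : x = b
  · subst hx
    simp [permIncidence]
    grind
  · simp [permIncidence, joinCycles_inr_of_ne hx, hx]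

lemma permIncidence_inl_inr {x : X} {y : Y} :
    permIncidence (joinCycles g₁ g₂ a b) (sumCongr h₁ h₂) (Sum.inl x) (Sum.inr y) ↔
      x = a ∧ y = g₂ b := by
  by_cases hx : x = a
  · subst hx
    simp [permIncidence]
  · simp [permIncidence, joinCycles_inl_of_ne hx, hx]

lemma permIncidence_inr_inl {x : Y} {y : X} :
    permIncidence (joinCycles g₁ g₂ a b) (sumCongr h₁ h₂) (Sum.inr x) (Sum.inl y) ↔
      x = b ∧ y = g₁ a := by
  by_cases hx : x = b
  · subst hx
    simp [permIncidence]
  · simp [permIncidence, joinCycles_inr_of_ne hx, hx]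

lemma joinCycles_cyclic (H₁ : IsHamiltonianPair g₁ h₁) (H₂ : IsHamiltonianPair g₂ h₂)
    (S : Set (X ⊕ Y)) (hS : S.Nonempty) (hg : ∀ x ∈ S, joinCycles g₁ g₂ a b x ∈ S) :
    S = Set.univ := by
  have hl (x : X) (hx : x ≠ a) (hxS : Sum.inl x ∈ S) : Sum.inl (g₁ x) ∈ S :=
    joinCycles_inl_of_ne (g₁ := g₁) (g₂ := g₂) (b := b) hx ▸ hg _ hxS
  have hr (y : Y) (hy : y ≠ b) (hyS : Sum.inr y ∈ S) : Sum.inr (g₂ y) ∈ S :=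
    joinCycles_inr_of_ne (g₁ := g₁) (g₂ := g₂) (a := a) hy ▸ hg _ hyS
  -- If S avoided a, its trace on the first summand would be closed under g₁, hence everything.
  have hla (x : X) (hx : Sum.inl x ∈ S) : Sum.inl a ∈ S := by
    by_contra ha
    exact ha ((H₁.cyclic {x | Sum.inl x ∈ S} ⟨x, hx⟩ fun z hz =>
      hl z (by rintro rfl; exact ha hz) hz).symm ▸ Set.mem_univ a :)
  have hrb (y : Y) (hy : Sum.inr y ∈ S) : Sum.inr b ∈ S := by
    by_contra hb
    exact hb ((H₂.cyclic {y | Sum.inr y ∈ S} ⟨y, hy⟩ fun z hz =>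
      hr z (by rintro rfl; exact hb hz) hz).symm ▸ Set.mem_univ b :)
  have hab (ha : Sum.inl a ∈ S) : Sum.inr (g₂ b) ∈ S := by simpa using hg _ ha
  have hba (hb : Sum.inr b ∈ S) : Sum.inl (g₁ a) ∈ S := by simpa using hg _ hb
  have hboth : Sum.inl a ∈ S ∧ Sum.inr b ∈ S := by
    obtain ⟨x | y, h⟩ := hS
    · exact ⟨hla x h, hrb _ (hab (hla x h))⟩
    · exact ⟨hla _ (hba (hrb y h)), hrb y h⟩
  have h₁ := H₁.cyclic {x | Sum.inl x ∈ S} ⟨a, hboth.1⟩ fun z hz => by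
    by_cases hza : z = a
    · exact hza ▸ hba hboth.2
    · exact hl z hza hz
  have h₂ := H₂.cyclic {y | Sum.inr y ∈ S} ⟨b, hboth.2⟩ fun z hz => by
    by_cases hzb : z = b
    · exact hzb ▸ hab hboth.1
    · exact hr z hzb hz
  refine Set.eq_univ_of_forall ?_
  rintro (x | y)
  · exact Set.eq_univ_iff_forall.1 h₁ x
  · exact Set.eq_univ_iff_forall.1 h₂ y

/-- The two new flags (a, g₂ b) and (b, g₁ a) are the only edges between the summands, so a cycle
uses both or neither. If a 4-cycle or 6-cycle used both, its other two or four edges would split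
into two paths of odd length joining a to g₁ a and b to g₂ b. One of these would be a single edge,
namely a deleted flag. -/
theorem join (H₁ : IsHamiltonianPair g₁ h₁) (H₂ : IsHamiltonianPair g₂ h₂) (a : X) (b : Y) :
    IsHamiltonianPair (joinCycles g₁ g₂ a b) (sumCongr h₁ h₂) where
  cyclic := joinCycles_cyclic H₁ H₂
  ne := by
    rintro (x | y)
    · by_cases hx : x = a
      · subst hx
        simpa using (H₁.ne x).2.1
      · simpa [joinCycles_inl_of_ne hx] using H₁.ne x
    · by_cases hy : y = b
      · subst hy
        simpa using (H₂.ne y).2.1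
      · simpa [joinCycles_inr_of_ne hy] using H₂.ne y
  linear := by
    have hl₁ := H₁.linear
    have hl₂ := H₂.linear
    unfold IsLinear at hl₁ hl₂
    rintro (p | p) (q | q) (l | l) (m | m) e₁ e₂ e₃ e₄ <;>
      simp only [permIncidence_inl_inl H₁, permIncidence_inr_inr H₂, permIncidence_inl_inr,
        permIncidence_inr_inl] at e₁ e₂ e₃ e₄ <;>
      grind
  triangleFree := by
    have ht₁ := H₁.triangleFree
    have ht₂ := H₂.triangleFree
    rintro (p | p) (q | q) (r | r) (l | l) (m | m) (n | n) e₁ e₂ e₃ e₄ e₅ e₆ d₁ d₂ d₃ d₄ d₅ d₆ <;>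
      simp only [permIncidence_inl_inl H₁, permIncidence_inr_inr H₂, permIncidence_inl_inr,
        permIncidence_inr_inl, ne_eq, Sum.inl.injEq, Sum.inr.injEq]
        at e₁ e₂ e₃ e₄ e₅ e₆ d₁ d₂ d₃ d₄ d₅ d₆ <;>
      -- The first two alternatives treat triangles inside one summand; `grind` refutes the mixed
      -- ones.
      first
      | exact ht₁ p q r l m n e₁.1 e₂.1 e₃.1 e₄.1 e₅.1 e₆.1 d₁ d₂ d₃ d₄ d₅ d₆
      | exact ht₂ p q r l m n e₁.1 e₂.1 e₃.1 e₄.1 e₅.1 e₆.1 d₁ d₂ d₃ d₄ d₅ d₆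
      | grind

omit [DecidableEq X] [DecidableEq Y] in
lemma transport (H : IsHamiltonianPair g h) (e : X ≃ Y) :
    ∃ g' h' : Perm Y, IsHamiltonianPair g' h' := by
  have hI {x y : Y} : permIncidence (e.permCongr g) (e.permCongr h) x y ↔
      permIncidence g h (e.symm x) (e.symm y) := by
    simp [permIncidence, Equiv.symm_apply_eq]
  refine ⟨e.permCongr g, e.permCongr h, ⟨?_, ?_, ?_, ?_⟩⟩
  · intro S ⟨y, hy⟩ hS
    have := H.cyclic (e ⁻¹' S) ⟨e.symm y, by simpa⟩ fun x hx => by simpa using hS _ hx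
    rwa [Set.preimage_eq_univ_iff, e.range_eq_univ, Set.univ_subset_iff] at this
  · intro y
    simpa [← Equiv.symm_apply_eq] using H.ne (e.symm y)
  · intro p q l m
    simpa [hI] using H.linear (e.symm p) (e.symm q) (e.symm l) (e.symm m)
  · intro p q r l m n
    simpa [hI] using H.triangleFree (e.symm p) (e.symm q) (e.symm r) (e.symm l) (e.symm m)
      (e.symm n)

end IsHamiltonianPair

end Existence

/-! ### Small cases by computation, and all sizes by joining -/

section Tables

/-- The lines on a point, when the third permutation is given by the list of its values. -/
def tableLines (n : ℕ) (t : List ℕ) (p : ℕ) : List ℕ := [p, (p + 1) % n, t.getD p 0]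

/-- The points on a line, when the third permutation is given by the list of its values. -/
def tablePoints (n : ℕ) (t : List ℕ) (l : ℕ) : List ℕ := [l, (l + (n - 1)) % n, t.idxOf l]

/-- The list is a permutation of the numbers below `n`, and together with the identity and the
cyclic shift it defines a cubic incidence relation without digons and triangles. -/
def IsGoodTable (n : ℕ) (t : List ℕ) : Prop :=
  (∀ p < n, t.getD p 0 < n ∧ t.idxOf p < n ∧ t.idxOf (t.getD p 0) = p ∧
    t.getD (t.idxOf p) 0 = p) ∧
  (∀ p < n, p ≠ (p + 1) % n ∧ p ≠ t.getD p 0 ∧ (p + 1) % n ≠ t.getD p 0) ∧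
  ∀ p < n, ∀ l ∈ tableLines n t p, ∀ q ∈ tablePoints n t l, q ≠ p →
    ∀ m ∈ tableLines n t q, m ≠ l → m ∉ tableLines n t p ∧
      ∀ r ∈ tablePoints n t m, r ≠ q → r ≠ p →
        ∀ k ∈ tableLines n t r, k ≠ m → k ≠ l → k ∉ tableLines n t p

-- All quantifiers are bounded by n or by lists of length three, so the search for short cycles can
-- be evaluated in the kernel.
set_option synthInstance.maxSize 1000 in
set_option synthInstance.maxHeartbeats 200000 in
instance (n : ℕ) (t : List ℕ) : Decidable (IsGoodTable n t) := by
  unfold IsGoodTable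
  infer_instance

/-- A configuration with a given number of points as a pair of permutations. -/
def ExistsHamiltonianPair (n : ℕ) : Prop := ∃ g h : Equiv.Perm (Fin n), IsHamiltonianPair g h

lemma Fin.eq_univ_of_add_one_mem {n : ℕ} [NeZero n] (S : Set (Fin n)) (hS : S.Nonempty)
    (h : ∀ x ∈ S, x + 1 ∈ S) : S = Set.univ := by
  obtain ⟨x, hx⟩ := hS
  have key (k : ℕ) : x + Fin.ofNat n k ∈ S := by
    induction k with
    | zero => simpa using hx
    | succ k ih =>
      have : x + Fin.ofNat n (k + 1) = x + Fin.ofNat n k + 1 := by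
        rw [add_assoc]
        congr 1
        ext
        simp [Fin.val_add]
      exact this ▸ h _ ih
  refine Set.eq_univ_of_forall fun y => ?_
  have := key (y - x).val
  simpa using this

/-- The first clause makes `getD` and `idxOf` mutually inverse below n, so the default 0 and the
index of an absent entry do no harm. The last clause follows p, l, q, m, r, k and rules out closing
up after four or six steps. -/
lemma IsGoodTable.existsHamiltonianPair {n : ℕ} [NeZero n] {t : List ℕ}
    (ht : IsGoodTable n t) : ExistsHamiltonianPair n := by
  obtain ⟨hinv, hne, hcyc⟩ := ht
  let h : Equiv.Perm (Fin n) :=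
    ⟨fun p => ⟨t.getD p 0, (hinv p p.2).1⟩, fun l => ⟨t.idxOf l.1, (hinv l l.2).2.1⟩,
      fun p => Fin.ext (hinv p p.2).2.2.1, fun l => Fin.ext (hinv l l.2).2.2.2⟩
  have hadd (p : Fin n) : ((p + 1 : Fin n) : ℕ) = (p + 1) % n := by
    simp [Fin.val_add]
  have hlines {p l} (hpl : permIncidence (Equiv.addRight 1) h p l) :
      l.1 ∈ tableLines n t p := by
    rcases hpl with rfl | rfl | rfl
    · simp [tableLines]
    · simp [tableLines, hadd]
    · simp [tableLines, h]
  have hpoints {p l} (hpl : permIncidence (Equiv.addRight 1) h p l) :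
      p.1 ∈ tablePoints n t l := by
    rcases hpl with rfl | rfl | rfl
    · simp [tablePoints]
    · have : ((p.1 + 1) % n + (n - 1)) % n = p := by
        have := NeZero.pos n
        rw [Nat.mod_add_mod, add_assoc, Nat.add_sub_cancel' this, Nat.add_mod_right,
          Nat.mod_eq_of_lt p.2]
      simp only [tablePoints, Equiv.coe_addRight, hadd, this, List.mem_cons, true_or, or_true]
    · have : t.idxOf (h p).1 = p := (hinv p p.2).2.2.1
      simp only [tablePoints, this, List.mem_cons, true_or, or_true]
  refine ⟨Equiv.addRight 1, h, ⟨fun S hS hg => Fin.eq_univ_of_add_one_mem S hS hg, ?_, ?_, ?_⟩⟩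
  · intro p
    simp only [ne_eq, Fin.ext_iff, Equiv.coe_addRight, hadd]
    exact hne p p.2
  · intro p q l m h₁ h₂ h₃ h₄
    by_contra! hpq
    simp only [ne_eq, Fin.ext_iff] at hpq
    exact (hcyc p p.2 l (hlines h₁) q (hpoints h₂) (Ne.symm hpq.1) m (hlines h₃)
      (Ne.symm hpq.2)).1 (hlines h₄)
  · intro p q r l m k h₁ h₂ h₃ h₄ h₅ h₆ hpq hqr hpr hlm hmk hlk
    rw [ne_eq, Fin.ext_iff] at hpq hqr hpr hlm hmk hlk
    exact (hcyc p p.2 l (hlines h₁) q (hpoints h₂) (Ne.symm hpq) m (hlines h₃)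
      (Ne.symm hlm)).2 r (hpoints h₄) (Ne.symm hqr) (Ne.symm hpr) k (hlines h₅) (Ne.symm hmk)
      (Ne.symm hlk) (hlines h₆)

/-- The differences h x − x modulo 15 repeat the pattern 4, 5, 9; the result is the Cremona–Richmond
configuration, with the Tutte–Coxeter graph as Levi graph. -/
lemma existsHamiltonianPair_15 : ExistsHamiltonianPair 15 :=
  IsGoodTable.existsHamiltonianPair
    (t := [4, 6, 11, 7, 9, 14, 10, 12, 2, 13, 0, 5, 1, 3, 8])
    (by decide +kernel)

lemma existsHamiltonianPair_17 : ExistsHamiltonianPair 17 :=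
  IsGoodTable.existsHamiltonianPair
    (t := [14, 5, 9, 11, 8, 10, 3, 12, 0, 13, 15, 1, 16, 4, 7, 2, 6])
    (by decide +kernel)

lemma existsHamiltonianPair_18 : ExistsHamiltonianPair 18 :=
  IsGoodTable.existsHamiltonianPair
    (t := [4, 13, 9, 14, 10, 17, 1, 16, 0, 15, 7, 3, 5, 8, 6, 12, 2, 11])
    (by decide +kernel)

lemma existsHamiltonianPair_19 : ExistsHamiltonianPair 19 :=
  IsGoodTable.existsHamiltonianPair
    (t := [14, 8, 13, 0, 17, 11, 16, 4, 18, 3, 1, 15, 7, 5, 9, 2, 10, 12, 6])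
    (by decide +kernel)

lemma existsHamiltonianPair_20 : ExistsHamiltonianPair 20 :=
  IsGoodTable.existsHamiltonianPair
    (t := [4, 13, 6, 17, 8, 15, 0, 16, 18, 3, 1, 5, 9, 7, 10, 19, 11, 14, 2, 12])
    (by decide +kernel)

lemma existsHamiltonianPair_21 : ExistsHamiltonianPair 21 :=
  IsGoodTable.existsHamiltonianPair
    (t := [14, 10, 6, 11, 19, 12, 15, 1, 5, 13, 17, 0, 16, 3, 18, 4, 20, 8, 2, 7, 9])
    (by decide +kernel)

lemma existsHamiltonianPair_22 : ExistsHamiltonianPair 22 :=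
  IsGoodTable.existsHamiltonianPair
    (t := [4, 12, 7, 10, 16, 18, 0, 19, 21, 6, 20, 5, 8, 3, 11, 9, 13, 2, 15, 1, 17, 14])
    (by decide +kernel)

lemma existsHamiltonianPair_23 : ExistsHamiltonianPair 23 :=
  IsGoodTable.existsHamiltonianPair
    (t := [14, 9, 6, 22, 18, 0, 16, 12, 15, 21, 4, 1, 5, 17, 3, 20, 10, 2, 8, 11, 13, 7, 19])
    (by decide +kernel)

lemma existsHamiltonianPair_24 : ExistsHamiltonianPair 24 :=
  IsGoodTable.existsHamiltonianPair
    (t := [4, 18, 13, 10, 21, 12, 15, 3, 16, 6, 20, 1, 23, 9, 0, 22, 11, 7, 5, 14, 8, 2, 19,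
      17])
    (by decide +kernel)

lemma existsHamiltonianPair_25 : ExistsHamiltonianPair 25 :=
  IsGoodTable.existsHamiltonianPair
    (t := [14, 9, 7, 0, 8, 23, 13, 18, 16, 19, 17, 2, 4, 22, 5, 24, 20, 1, 15, 12, 6, 10, 3, 11,
      21])
    (by decide +kernel)

lemma existsHamiltonianPair_26 : ExistsHamiltonianPair 26 :=
  IsGoodTable.existsHamiltonianPair
    (t := [4, 23, 20, 12, 19, 22, 3, 13, 1, 14, 5, 15, 25, 17, 2, 6, 0, 11, 7, 24, 10, 8, 18,
      16, 9, 21])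
    (by decide +kernel)

lemma existsHamiltonianPair_27 : ExistsHamiltonianPair 27 :=
  IsGoodTable.existsHamiltonianPair
    (t := [14, 11, 13, 21, 23, 18, 25, 0, 12, 3, 7, 22, 5, 20, 4, 9, 2, 8, 10, 24, 6, 26, 16, 1,
      15, 17, 19])
    (by decide +kernel)

lemma existsHamiltonianPair_28 : ExistsHamiltonianPair 28 :=
  IsGoodTable.existsHamiltonianPair
    (t := [4, 6, 10, 7, 17, 24, 18, 16, 26, 5, 0, 15, 20, 22, 9, 2, 25, 21, 23, 3, 1, 11, 8, 27,
      13, 19, 12, 14])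
    (by decide +kernel)

lemma existsHamiltonianPair_29 : ExistsHamiltonianPair 29 :=
  IsGoodTable.existsHamiltonianPair
    (t := [14, 21, 11, 19, 1, 26, 22, 13, 15, 28, 7, 0, 5, 18, 3, 12, 23, 10, 24, 8, 16, 25, 4,
      27, 9, 17, 2, 20, 6])
    (by decide +kernel)

lemma existsHamiltonianPair_31 : ExistsHamiltonianPair 31 :=
  IsGoodTable.existsHamiltonianPair
    (t := [14, 7, 16, 25, 23, 15, 30, 24, 5, 28, 4, 21, 26, 10, 27, 29, 0, 9, 6, 3, 17, 8, 19,
      13, 18, 1, 22, 2, 12, 20, 11])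
    (by decide +kernel)

lemma ExistsHamiltonianPair.add {m n : ℕ} [NeZero m] [NeZero n] (hm : ExistsHamiltonianPair m)
    (hn : ExistsHamiltonianPair n) : ExistsHamiltonianPair (m + n) := by
  obtain ⟨g₁, h₁, H₁⟩ := hm
  obtain ⟨g₂, h₂, H₂⟩ := hn
  exact (H₁.join H₂ 0 0).transport finSumFinEquiv

theorem existsHamiltonianPair_of_eq_or_le (n : ℕ) (hn : n = 15 ∨ 17 ≤ n) :
    ExistsHamiltonianPair n := by
  induction n using Nat.strong_induction_on with
  | _ n ih =>
    -- These are the sizes for which n − 15 is again admissible; 31 is not among them, because 16 is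
    -- impossible.
    by_cases hb : n = 30 ∨ 32 ≤ n
    · have : NeZero (n - 15) := ⟨by omega⟩
      have := (ih (n - 15) (by omega) (by omega)).add existsHamiltonianPair_15
      rwa [Nat.sub_add_cancel (by omega)] at this
    · have : n ≤ 31 := by omega
      interval_cases n
      all_goals first
        | omega
        | exact existsHamiltonianPair_15
        | exact existsHamiltonianPair_17
        | exact existsHamiltonianPair_18
        | exact existsHamiltonianPair_19
        | exact existsHamiltonianPair_20
        | exact existsHamiltonianPair_21
        | exact existsHamiltonianPair_22
        | exact existsHamiltonianPair_23
        | exact existsHamiltonianPair_24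
        | exact existsHamiltonianPair_25
        | exact existsHamiltonianPair_26
        | exact existsHamiltonianPair_27
        | exact existsHamiltonianPair_28
        | exact existsHamiltonianPair_29
        | exact existsHamiltonianPair_31

end Tables

/-! ### From incidence relations back to configurations and graphs -/

/-- A cubic linear incidence relation as a configuration on its points. -/
noncomputable def IsCubicIncidence.configuration {P L : Type*} [Fintype P] [DecidableEq P]
    [Fintype L] {I : P → L → Prop} (h : IsCubicIncidence I) (hl : IsLinear I) :
    SymmetricConfiguration3 P :=
  -- A line is determined by any two of its points, so lines may be replaced by their point sets.
  have hinj : Function.Injective fun l => ({p | I p l} : Set P).toFinite.toFinset := by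
    intro l m hlm
    have hlm : {p | I p l} = {p | I p m} := by simpa using hlm
    obtain ⟨p, q, r, hpq, -, -, hs⟩ := Set.ncard_eq_three.1 (h.points l)
    have hp : p ∈ {p | I p l} := by simp [hs]
    have hq : q ∈ {p | I p l} := by simp [hs]
    exact (hl p q l m hp hq (hlm ▸ hq :) (hlm ▸ hp :)).resolve_left hpq
  { blocks := Finset.univ.map ⟨_, hinj⟩
    card_blocks := by rw [Finset.card_map, Finset.card_univ, h.card_eq]
    card_of_mem := by
      simp only [Finset.mem_map, Finset.mem_univ, true_and, Function.Embedding.coeFn_mk]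
      rintro _ ⟨l, rfl⟩
      rw [← Set.ncard_eq_toFinset_card, h.points]
    card_through := by
      intro p
      rw [Finset.filter_map, Finset.card_map]
      classical
      rw [← h.card_lines p]
      congr! 1
      ext l
      simp
    eq_of_pair := by
      simp only [Finset.mem_map, Finset.mem_univ, true_and, Function.Embedding.coeFn_mk]
      rintro p q hpq _ ⟨l, rfl⟩ _ ⟨m, rfl⟩ h₁ h₂ h₃ h₄
      simp only [Set.Finite.mem_toFinset, Set.mem_ofPred_eq] at h₁ h₂ h₃ h₄
      rw [(hl p q l m h₁ h₂ h₄ h₃).resolve_left hpq] }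

lemma IsCubicIncidence.mem_blocks_configuration {P L : Type*} [Fintype P] [DecidableEq P]
    [Fintype L] {I : P → L → Prop} (h : IsCubicIncidence I) (hl : IsLinear I) {B : Finset P} :
    B ∈ (h.configuration hl).blocks ↔ ∃ l, ({p | I p l} : Set P).toFinite.toFinset = B := by
  rw [configuration, Finset.mem_map]
  simp only [Finset.mem_univ, true_and]
  rfl

/-- Injectivity of the map from blocks to lines suffices to carry a triangle of blocks to a triangle
of lines. -/
lemma IsCubicIncidence.exists_incident_iff {P L : Type*} [Fintype P] [DecidableEq P]
    [Fintype L] {I : P → L → Prop} (h : IsCubicIncidence I) (hl : IsLinear I) :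
    ∃ e : {B // B ∈ (h.configuration hl).blocks} → L, e.Injective ∧
      ∀ p B, (h.configuration hl).Incident p B ↔ I p (e B) := by
  choose e he using fun B : {B // B ∈ (h.configuration hl).blocks} =>
    (h.mem_blocks_configuration hl).1 B.2
  refine ⟨e, fun B B' hBB => Subtype.ext ?_, fun p B => ?_⟩
  · rw [← he, ← he, hBB]
  · simp [SymmetricConfiguration3.Incident, ← he]

theorem exists_connected_configuration (v : ℕ) (hv : v = 15 ∨ 17 ≤ v) :
    ∃ C : SymmetricConfiguration3 (Fin v), C.Connected ∧ ¬ C.HasTriangle := by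
  obtain ⟨g, h, H⟩ := existsHamiltonianPair_of_eq_or_le v hv
  let C := H.isCubicIncidence.configuration H.linear
  obtain ⟨e, hinj, he⟩ := H.isCubicIncidence.exists_incident_iff H.linear
  refine ⟨C, ⟨⟨⟨0, by omega⟩⟩, C.isConnectedIncidence_iff.1 ?_⟩, C.isTriangleFree_iff.1 ?_⟩
  · intro S hS hcl
    refine H.isConnectedIncidence S hS fun p q l hp hpl hql => ?_
    have hB : ({p | permIncidence g h p l} : Set (Fin v)).toFinite.toFinset ∈ C.blocks :=
      (H.isCubicIncidence.mem_blocks_configuration H.linear).2 ⟨l, rfl⟩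
    exact hcl p q ⟨_, hB⟩ hp (by simpa [SymmetricConfiguration3.Incident])
      (by simpa [SymmetricConfiguration3.Incident])
  · intro p q r l m n h₁ h₂ h₃ h₄ h₅ h₆ hpq hqr hpr hlm hmn hln
    rw [he] at h₁ h₂ h₃ h₄ h₅ h₆
    exact H.triangleFree p q r (e l) (e m) (e n) h₁ h₂ h₃ h₄ h₅ h₆ hpq hqr hpr
      (hinj.ne hlm) (hinj.ne hmn) (hinj.ne hln)

theorem SymmetricConfiguration3.isCubicGraph_leviGraph {P : Type*} [Fintype P] [DecidableEq P]
    (C : SymmetricConfiguration3 P) : IsCubicGraph C.leviGraph :=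
  isCubicGraph_incidenceGraph C.isCubicIncidence

lemma SimpleGraph.Iso.isCubicGraph {V W : Type*} [Finite V] [Finite W] {G : SimpleGraph V}
    {H : SimpleGraph W} (e : G ≃g H) (hG : IsCubicGraph G) : IsCubicGraph H := by
  rw [isCubicGraph_iff] at hG ⊢
  intro w
  rw [← hG (e.symm w)]
  exact (Nat.card_congr (e.symm.mapNeighborSet w))

/-- The Levi graph of a configuration, on a standard vertex set. -/
lemma SymmetricConfiguration3.exists_graph {v : ℕ} (C : SymmetricConfiguration3 (Fin v))
    (hC : C.Connected) (ht : ¬ C.HasTriangle) : ∃ G : SimpleGraph (Fin (2 * v)),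
      G.Connected ∧ IsCubicGraph G ∧ G.IsBipartite ∧ 8 ≤ G.egirth := by
  have hcard := C.card_leviGraph
  rw [Fintype.card_fin] at hcard
  let e := Finite.equivFinOfCardEq hcard
  let i : C.leviGraph ≃g C.leviGraph.map e.toEmbedding := SimpleGraph.Iso.map e _
  refine ⟨C.leviGraph.map e.toEmbedding, i.connected_iff.1 (C.connected_leviGraph_iff.2 hC),
    i.isCubicGraph C.isCubicGraph_leviGraph, ?_, ?_⟩
  · exact (isBipartite_incidenceGraph C.Incident).of_hom i.symm.toHom
  · rw [← i.egirth_eq]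
    exact C.eight_le_egirth_leviGraph_iff.2 ht

theorem theorem2 (v : ℕ) :
    -- connected symmetric configurations `v_3` without triangles
    ((∃ C : SymmetricConfiguration3 (Fin v), C.Connected ∧ ¬ C.HasTriangle) ↔
      (v = 15 ∨ 17 ≤ v)) ∧
    -- connected cubic bipartite graphs of girth at least 8 on `2v` vertices
    ((∃ G : SimpleGraph (Fin (2 * v)),
        G.Connected ∧ IsCubicGraph G ∧ G.IsBipartite ∧ 8 ≤ G.egirth) ↔
      (v = 15 ∨ 17 ≤ v)) ∧
    -- the same without connectedness, for nonempty graphs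
    (0 < v →
      ((∃ G : SimpleGraph (Fin (2 * v)),
          IsCubicGraph G ∧ G.IsBipartite ∧ 8 ≤ G.egirth) ↔
        (v = 15 ∨ 17 ≤ v))) ∧
    -- the equivalence is realized by the Levi graph
    (∀ C : SymmetricConfiguration3 (Fin v),
      Nat.card (Fin v ⊕ {B : Finset (Fin v) // B ∈ C.blocks}) = 2 * v ∧
      IsCubicGraph C.leviGraph ∧ C.leviGraph.IsBipartite ∧
      (C.leviGraph.Connected ↔ C.Connected) ∧
      (8 ≤ C.leviGraph.egirth ↔ ¬ C.HasTriangle)) := by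
  have hno (G : SimpleGraph (Fin (2 * v))) [Nonempty (Fin (2 * v))] (hG : IsCubicGraph G)
      (hb : G.IsBipartite) (hg : 8 ≤ G.egirth) : v = 15 ∨ 17 ≤ v := by
    obtain ⟨w, hw, h⟩ := SimpleGraph.exists_card_of_isCubicGraph hG hb hg
    rw [Fintype.card_fin] at hw
    omega
  have hyes (hv : v = 15 ∨ 17 ≤ v) : ∃ G : SimpleGraph (Fin (2 * v)),
      G.Connected ∧ IsCubicGraph G ∧ G.IsBipartite ∧ 8 ≤ G.egirth := by
    obtain ⟨C, hC, ht⟩ := exists_connected_configuration v hv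
    exact C.exists_graph hC ht
  have hgraph : (∃ G : SimpleGraph (Fin (2 * v)),
      G.Connected ∧ IsCubicGraph G ∧ G.IsBipartite ∧ 8 ≤ G.egirth) ↔ (v = 15 ∨ 17 ≤ v) := by
    refine ⟨fun ⟨G, hc, hG, hb, hg⟩ => ?_, hyes⟩
    have := hc.nonempty
    exact hno G hG hb hg
  refine ⟨⟨fun ⟨C, hC, ht⟩ => hgraph.1 (C.exists_graph hC ht), exists_connected_configuration v⟩,
    hgraph, fun hv => ⟨fun ⟨G, hG, hb, hg⟩ => ?_, fun h => ?_⟩, fun C => ⟨?_, ?_, ?_, ?_, ?_⟩⟩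
  · have : Nonempty (Fin (2 * v)) := ⟨⟨0, by omega⟩⟩
    exact hno G hG hb hg
  · obtain ⟨G, -, hG⟩ := hyes h
    exact ⟨G, hG⟩
  · simpa using C.card_leviGraph
  · exact C.isCubicGraph_leviGraph
  · exact isBipartite_incidenceGraph C.Incident
  · exact C.connected_leviGraph_iff
  · exact C.eight_le_egirth_leviGraph_iff
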